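/- Let $X=\{X(s,T):(s,T)\in[0,1]^2\}$ be a real, jointly measurable random process with mean zero and covariance function $c((s,T),(s',T'))=\operatorname{cov}\{X(s,T),X(s',T')\}$. Let $g$ be a probability density on $[0,1]$, and let $\Sigma(s,s')=\int_0^1 c((s,T),(s',T))\,g(T)\,dT$ be the marginal covariance function. For subject $i=1,2,\dots$ the curves $Y_{ij}(s)=X_i(s,T_{ij})$, $s\in[0,1]$, $j=1,\dots,m_i$, are observed fully and without error. Here the $X_i$ are i.i.d. copies of $X$ and each visit time $T_{ij}$ has density $g$. The vector of visit times of a subject is independent of $X_i$ (its coordinates need not be independent of each other), and the pairs $(X_i,(T_{ij})_j)$ are independent over $i$; independence refers to the whole sample points of the processes, i.e. $X_i=X(U_i;\cdot,\cdot)$ with $U_i$ i.i.d. random elements of the sample space of $X$. The numbers of visits $m_i\ge 1$ are deterministic and sparse in the sense that $\sum_{i\le n}m_i^2/(\sum_{i\le n}m_i)^2\to0$ as $n\to\infty$ (for instance, bounded). Let $$\widehat\Sigma_n(s,s')=\frac{\sum_{i=1}^n\sum_{j=1}^{m_i}Y_{ij}(s)Y_{ij}(s')}{\sum_{i=1}^n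 m_i}$$ be the pooled sample covariance. Let $\lambda_1\ge\lambda_2\ge\dots\ge0$ be the eigenvalues, listed with multiplicity, and $\phi_1,\phi_2,\dots$ corresponding orthonormal eigenfunctions in $L^2[0,1]$ from a spectral decomposition of the integral operator with kernel $\Sigma$; let $\widehat\lambda_k,\widehat\phi_k$ be the same for $\widehat\Sigma_n$ (for any choice of the eigenfunctions), with the sign of $\widehat\phi_k$ chosen so that $\langle\widehat\phi_k,\phi_k\rangle\ge0$. Assume: (A1) $\mathrm E\big[\iint X^2(s,T)\,ds\,dT\big]<\infty$; (A2) $g$ is continuous, and hence bounded, on $[0,1]$; (A4) $\mathrm E\big[\|X(\cdot,T)\|_{L^2}^4\big]<\infty$ for each $T\in[0,1]$; (A5) $\lambda_k>0$ for all $k$ and $\lambda_1>\lambda_2>\cdots$ (no crossings or ties among the eigenvalues). Then for each $k$, as $n\to\infty$, $$|\widehat\lambda_k-\lambda_k|\xrightarrow{\ p\ }0\qquad\text{and}\qquad\|\widehat\phi_k-\phi_k\|_{L^2}\xrightarrow{\ p\ }0 .$$ -/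

import Mathlib

open MeasureTheory ProbabilityTheory Filter Topology
open scoped unitInterval

noncomputable section

/-- The Hilbert space `L²[0,1]` of (classes of) real square integrable functions. -/
abbrev L2I : Type := Lp ℝ 2 (volume : Measure I)

/-- Covariance function `c((s,t),(s',t')) = cov{X(s,t), X(s',t')}` of a process `X` that is defined
on a probability space `(E, P)`. -/
def covFun {E : Type*} [MeasurableSpace E] (P : Measure E) (X : E → I → I → ℝ)
    (s t s' t' : I) : ℝ :=
  covariance (fun e => X e s t) (fun e => X e s' t') P

/-- Marginal covariance function `Σ(s,s') = ∫ c((s,t),(s',t)) g(t) dt`. -/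
def marginalCov {E : Type*} [MeasurableSpace E] (P : Measure E) (X : E → I → I → ℝ)
    (g : I → ℝ) (s s' : I) : ℝ :=
  ∫ t, covFun P X s t s' t * g t

/-- Pooled sample covariance of the first `n` subjects,
`(∑_{i<n} ∑_{j<mᵢ} Y i j s * Y i j s') / ∑_{i<n} mᵢ`. -/
def sampleCov (m : ℕ → ℕ) (Y : ℕ → ℕ → I → ℝ) (n : ℕ) (s s' : I) : ℝ :=
  (∑ i ∈ Finset.range n, ∑ j ∈ Finset.range (m i), Y i j s * Y i j s') /
    ∑ i ∈ Finset.range n, (m i : ℝ)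

/-- `(ev k, ef k)`, `k = 0, 1, 2, …`, is the spectral decomposition of the (symmetric, positive
semidefinite, square integrable) kernel `κ` on `[0,1]²`: the `ef k` are orthonormal eigenfunctions
in `L²[0,1]` of the integral operator of `κ`, their eigenvalues `ev k` are listed in decreasing order
with multiplicity, and none is missing: the operator vanishes on the orthogonal complement of the
`ef k`. -/
structure IsSpectralDecomposition (κ : I → I → ℝ) (ev : ℕ → ℝ) (ef : ℕ → L2I) : Prop where
  antitone : Antitone ev
  nonneg : ∀ k, 0 ≤ ev k
  orthonormal : Orthonormal ℝ ef
  eigen : ∀ k, ∀ᵐ s : I, ∫ s' : I, κ s s' * ef k s' = ev k * ef k s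
  complete : ∀ f : L2I, (∀ k, inner ℝ (ef k) f = 0) → ∀ᵐ s : I, ∫ s' : I, κ s s' * f s' = 0

end

/-! Both kernels are second moment kernels `∫ x(s) x(s') dρ`: `Σ` for the joint law `ν` of process
and visit time, the sample covariance for the empirical measure of the pooled pairs
(`marginalCov_eq_secondMoment`, `secondMoment_empirical`). Hence it suffices to prove a weak law of
large numbers in operator norm and to combine it with deterministic perturbation theory.

The law of large numbers (`tendsto_measure_kernelForm_empirical`) truncates to paths of squared norm
at most `M`. For the truncated kernels, independence across subjects bounds the mean squared
Hilbert–Schmidt error by `M² ∑ mᵢ² / (∑ mᵢ)²`. The discarded parts are controlled in operator norm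
by the integrated squared norm of the discarded paths; its expectation is the same for the empirical
measure as for `ν`, and small for large `M`, so Markov's inequality applies.

The perturbation theory is Weyl's inequality for the eigenvalues and a bound of Davis–Kahan type for
the eigenvectors, with constants depending only on the gap around `ev k`. -/

/-! ### Perturbation of eigenvalues and eigenvectors in a Hilbert space -/

section Perturbation

variable {H : Type*} [NormedAddCommGroup H] [InnerProductSpace ℝ H]

/-- The sequences `ev`, `ef` diagonalize the bounded operator `A` (spectral decomposition with
eigenvalues in decreasing order). -/
structure IsDiagonalization (A : H →L[ℝ] H) (ev : ℕ → ℝ) (ef : ℕ → H) : Prop where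
  antitone : Antitone ev
  nonneg : ∀ k, 0 ≤ ev k
  orthonormal : Orthonormal ℝ ef
  eigen : ∀ k, A (ef k) = ev k • ef k
  complete : ∀ f, (∀ k, inner ℝ (ef k) f = 0) → A f = 0

/-- By Bessel, the Fourier series converges. The remainder `w` is needed because eigenvectors may
fail to span; the operator annihilates it. -/
theorem Orthonormal.exists_hasSum_sub [CompleteSpace H] {f : ℕ → H} (hf : Orthonormal ℝ f)
    (v : H) : ∃ w, (∀ i, inner ℝ (f i) w = 0) ∧
      HasSum (fun i => inner ℝ (f i) v • f i) (v - w) := by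
  have hs : Summable (fun i => inner ℝ (f i) v • f i) := by
    have h := (hf.orthogonalFamily.summable_iff_norm_sq_summable
      (fun i => inner ℝ (f i) v)).2 (by simpa using hf.inner_products_summable (x := v))
    simpa using h
  obtain ⟨u, hu⟩ := hs
  refine ⟨v - u, fun i => ?_, by simpa using hu⟩
  have h1 : HasSum (fun j => inner ℝ (f i) (inner ℝ (f j) v • f j)) (inner ℝ (f i) u) :=
    hu.mapL (innerSL ℝ (f i))
  have h2 : HasSum (fun j => inner ℝ (f i) (inner ℝ (f j) v • f j)) (inner ℝ (f i) v) := by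
    convert hasSum_single i (f := fun j => inner ℝ (f i) (inner ℝ (f j) v • f j)) ?_ using 1
    · simp [inner_smul_right, hf.1 i]
    · intro j hj
      simp [inner_smul_right, hf.2 (Ne.symm hj)]
  rw [inner_sub_right, h1.unique h2, sub_self]

namespace IsDiagonalization

variable {A B : H →L[ℝ] H} {ev ev' : ℕ → ℝ} {ef ef' : ℕ → H}

/-- The upper half of Courant–Fischer: in the eigenexpansion of `v` only eigenvalues with index at
least `k` occur. -/
theorem inner_map_self_le [CompleteSpace H] (h : IsDiagonalization A ev ef) (k : ℕ) (v : H)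
    (hv : ∀ i < k, inner ℝ (ef i) v = 0) : inner ℝ v (A v) ≤ ev k * ‖v‖ ^ 2 := by
  obtain ⟨w, hw, hs⟩ := h.orthonormal.exists_hasSum_sub v
  have hA : HasSum (fun i => inner ℝ v (A (inner ℝ (ef i) v • ef i))) (inner ℝ v (A v)) := by
    have h1 := (hs.mapL A).mapL (innerSL ℝ v)
    simpa [map_sub, h.complete w hw, real_inner_smul_right] using h1
  have hI : HasSum (fun i => ev k * inner ℝ v (inner ℝ (ef i) v • ef i))
      (ev k * inner ℝ v (v - w)) := (hs.mapL (innerSL ℝ v)).mul_left _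
  have hvw : inner ℝ v w = ‖w‖ ^ 2 := by
    have h1 : HasSum (fun i => inner ℝ w (inner ℝ (ef i) v • ef i)) (inner ℝ w (v - w)) :=
      hs.mapL (innerSL ℝ w)
    have h2 : inner ℝ w (v - w) = 0 := by
      refine h1.unique ?_
      convert (hasSum_zero : HasSum (fun _ : ℕ => (0 : ℝ)) 0) using 2 with i
      rw [inner_smul_right, real_inner_comm (ef i) w, hw i, mul_zero]
    rw [inner_sub_right, real_inner_self_eq_norm_sq] at h2
    rw [real_inner_comm]
    linarith
  have hle : inner ℝ v (A v) ≤ ev k * inner ℝ v (v - w) := by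
    refine hasSum_le (fun i => ?_) hA hI
    rw [map_smul, h.eigen, inner_smul_right, inner_smul_right, inner_smul_right,
      real_inner_comm (ef i) v]
    by_cases hi : i < k
    · simp [hv i hi]
    · have := h.antitone (not_lt.1 hi)
      nlinarith [mul_self_nonneg (inner ℝ (ef i) v)]
  refine hle.trans (mul_le_mul_of_nonneg_left ?_ (h.nonneg k))
  rw [inner_sub_right, hvw, real_inner_self_eq_norm_sq]
  nlinarith [sq_nonneg ‖w‖]

/-- By dimension count, the span of `ef' 0, …, ef' k` contains a nonzero `v` orthogonal to `ef 0, …,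
ef (k - 1)`. The quadratic form of `B` at `v` is at least `ev' k * ‖v‖ ^ 2`, that of `A` at most `ev
k * ‖v‖ ^ 2`. -/
theorem eigenvalue_le [CompleteSpace H] (h : IsDiagonalization A ev ef)
    (h' : IsDiagonalization B ev' ef') (k : ℕ) : ev' k ≤ ev k + ‖A - B‖ := by
  let L : (Fin (k + 1) → ℝ) →ₗ[ℝ] (Fin k → ℝ) :=
    LinearMap.pi (fun j : Fin k => ∑ i : Fin (k + 1),
      (inner ℝ (ef j) (ef' i)) • LinearMap.proj i)
  have hL : LinearMap.ker L ≠ ⊥ := LinearMap.ker_ne_bot_of_finrank_lt (by simp)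
  obtain ⟨c, hc, hc0⟩ := (Submodule.ne_bot_iff _).1 hL
  set v : H := ∑ i : Fin (k + 1), c i • ef' i with hv
  have hortho : Orthonormal ℝ (fun i : Fin (k + 1) => ef' i) :=
    h'.orthonormal.comp _ Fin.val_injective
  have hnorm : ‖v‖ ^ 2 = ∑ i, c i ^ 2 := by
    rw [← real_inner_self_eq_norm_sq, hv, hortho.inner_sum]
    simp [sq]
  have hBv : B v = ∑ i : Fin (k + 1), (c i * ev' i) • ef' i := by
    rw [hv, map_sum]
    simp [h'.eigen, mul_smul]
  have hB : ev' k * ‖v‖ ^ 2 ≤ inner ℝ v (B v) := by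
    rw [hBv, hnorm, hv, hortho.inner_sum, Finset.mul_sum]
    refine Finset.sum_le_sum fun i _ => ?_
    have := h'.antitone (Nat.lt_succ_iff.1 i.2)
    simp only [conj_trivial]
    nlinarith [sq_nonneg (c i)]
  have hA := h.inner_map_self_le k v (fun i hi => by
    have h1 : L c ⟨i, hi⟩ = 0 := by rw [LinearMap.mem_ker.1 hc]; rfl
    rw [hv, inner_sum]
    simpa [L, inner_smul_right, mul_comm] using h1)
  have hAB : |inner ℝ v ((A - B) v)| ≤ ‖A - B‖ * ‖v‖ ^ 2 := by
    refine (abs_real_inner_le_norm _ _).trans ?_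
    nlinarith [(A - B).le_opNorm v, norm_nonneg v]
  have hpos : 0 < ‖v‖ ^ 2 := by
    rw [hnorm]
    obtain ⟨i, hi⟩ := Function.ne_iff.1 hc0
    have hi' : c i ≠ 0 := hi
    exact Finset.sum_pos' (fun _ _ => sq_nonneg _) ⟨i, Finset.mem_univ _, by positivity⟩
  rw [sub_apply, inner_sub_right] at hAB
  have := (abs_le.1 hAB).1
  exact le_of_mul_le_mul_right (by nlinarith) hpos

/-- Weyl's inequality. -/
theorem abs_eigenvalue_sub_le [CompleteSpace H] (h : IsDiagonalization A ev ef)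
    (h' : IsDiagonalization B ev' ef') (k : ℕ) : |ev' k - ev k| ≤ ‖A - B‖ := by
  have h1 := h.eigenvalue_le h' k
  have h2 := h'.eigenvalue_le h k
  rw [norm_sub_rev] at h2
  exact abs_le.2 ⟨by linarith, by linarith⟩

/-- Away from `ef k`, `A - l` is diagonal with entries of modulus at least `γ`; on the remainder `w`
it acts as `-l`, whence the condition on `|l|`. Parseval and Pythagoras conclude. -/
theorem gap_mul_norm_le [CompleteSpace H] (h : IsDiagonalization A ev ef) {γ l : ℝ} (hγ : 0 ≤ γ)
    {k : ℕ} (hgap : ∀ i ≠ k, γ ≤ |ev i - l|) (hl : γ ≤ |l|) {u : H}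
    (hu : inner ℝ (ef k) u = 0) : γ * ‖u‖ ≤ ‖A u - l • u‖ := by
  obtain ⟨w, hw, hs⟩ := h.orthonormal.exists_hasSum_sub u
  set s := u - w with hsdef
  have hus : u = s + w := by rw [hsdef]; abel
  have horth : ∀ z : H, HasSum (fun i => inner ℝ z (inner ℝ (ef i) u • ef i)) (inner ℝ z s) :=
    fun z => hs.mapL (innerSL ℝ z)
  have hefs : ∀ i, inner ℝ (ef i) s = inner ℝ (ef i) u := fun i => by
    rw [hsdef, inner_sub_right, hw, sub_zero]
  have hT : HasSum (fun i => ((ev i - l) * inner ℝ (ef i) u) • ef i) (A s - l • s) := by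
    convert (hs.mapL A).sub (hs.const_smul l) using 2 with i
    rw [map_smul, h.eigen, smul_smul, smul_smul, ← sub_smul]
    ring_nf
  have hefT : ∀ i, inner ℝ (ef i) (A s - l • s) = (ev i - l) * inner ℝ (ef i) u := by
    intro i
    have h1 : HasSum (fun j => inner ℝ (ef i) (((ev j - l) * inner ℝ (ef j) u) • ef j))
      (inner ℝ (ef i) (A s - l • s)) := hT.mapL (innerSL ℝ (ef i))
    refine h1.unique ?_
    convert hasSum_single i (f := fun j => inner ℝ (ef i)
      (((ev j - l) * inner ℝ (ef j) u) • ef j)) ?_ using 1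
    · simp [inner_smul_right, h.orthonormal.1 i]
    · intro j hj
      simp [inner_smul_right, h.orthonormal.2 (Ne.symm hj)]
  have hws : inner ℝ w s = 0 := by
    refine (horth w).unique ?_
    convert (hasSum_zero : HasSum (fun _ : ℕ => (0 : ℝ)) 0) using 2 with i
    rw [inner_smul_right, real_inner_comm (ef i) w, hw i, mul_zero]
  have hwT : inner ℝ w (A s - l • s) = 0 := by
    have h1 : HasSum (fun i => inner ℝ w (((ev i - l) * inner ℝ (ef i) u) • ef i))
      (inner ℝ w (A s - l • s)) := hT.mapL (innerSL ℝ w)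
    refine h1.unique ?_
    convert (hasSum_zero : HasSum (fun _ : ℕ => (0 : ℝ)) 0) using 2 with i
    rw [inner_smul_right, real_inner_comm (ef i) w, hw i, mul_zero]
  have hnT : HasSum (fun i => ((ev i - l) * inner ℝ (ef i) u) ^ 2) (‖A s - l • s‖ ^ 2) := by
    have h1 : HasSum (fun i => inner ℝ (A s - l • s) (((ev i - l) * inner ℝ (ef i) u) • ef i))
      (inner ℝ (A s - l • s) (A s - l • s)) := hT.mapL (innerSL ℝ (A s - l • s))
    rw [real_inner_self_eq_norm_sq] at h1
    convert h1 using 2 with i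
    rw [inner_smul_right, real_inner_comm (ef i), hefT, sq]
  have hns : HasSum (fun i => γ ^ 2 * (inner ℝ (ef i) u) ^ 2) (γ ^ 2 * ‖s‖ ^ 2) := by
    refine HasSum.mul_left _ ?_
    have h1 := horth s
    rw [real_inner_self_eq_norm_sq] at h1
    refine h1.congr_fun fun i => ?_
    rw [inner_smul_right, real_inner_comm (ef i), hefs, sq]
  have hle : γ ^ 2 * ‖s‖ ^ 2 ≤ ‖A s - l • s‖ ^ 2 := by
    refine hasSum_le (fun i => ?_) hns hnT
    by_cases hi : i = k
    · subst hi; simp [hu]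
    · rw [mul_pow]
      refine mul_le_mul_of_nonneg_right ?_ (sq_nonneg _)
      rw [← sq_abs (ev i - l)]
      exact pow_le_pow_left₀ hγ (hgap i hi) 2
  have hu2 : ‖u‖ ^ 2 = ‖s‖ ^ 2 + ‖w‖ ^ 2 := by
    rw [hus, @norm_add_sq_real, real_inner_comm, hws]; ring
  have hAu : A u - l • u = (A s - l • s) - l • w := by
    rw [hus, map_add, h.complete w hw, smul_add]; abel
  have hA2 : ‖A u - l • u‖ ^ 2 = ‖A s - l • s‖ ^ 2 + |l| ^ 2 * ‖w‖ ^ 2 := by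
    rw [hAu, @norm_sub_sq_real, inner_smul_right, real_inner_comm, hwT, norm_smul, mul_pow]
    simp
  have hl2 : γ ^ 2 ≤ |l| ^ 2 := pow_le_pow_left₀ hγ hl 2
  refine le_of_sq_le_sq ?_ (norm_nonneg _)
  rw [mul_pow, hu2, hA2]
  nlinarith [sq_nonneg ‖w‖]

/-- A perturbation bound for eigenvectors with the sign convention `0 ≤ ⟪ef' k, ef k⟫`. -/
theorem gap_mul_norm_eigenvector_sub_le [CompleteSpace H] (h : IsDiagonalization A ev ef)
    (h' : IsDiagonalization B ev' ef') {γ : ℝ} (hγ : 0 ≤ γ) {k : ℕ}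
    (hgap : ∀ i ≠ k, γ ≤ |ev i - ev k|) (hl : γ ≤ ev k)
    (hsign : 0 ≤ inner ℝ (ef' k) (ef k)) : γ * ‖ef' k - ef k‖ ≤ 4 * ‖A - B‖ := by
  set c := inner ℝ (ef' k) (ef k) with hc
  set u := ef' k - c • ef k with hu
  have hn := h.orthonormal.1 k
  have hn' := h'.orthonormal.1 k
  have hku : inner ℝ (ef k) u = 0 := by
    rw [hu, inner_sub_right, inner_smul_right, real_inner_self_eq_norm_sq, hn, real_inner_comm]
    simp [hc]
  have h1 := h.gap_mul_norm_le hγ hgap (hl.trans (le_abs_self _)) hku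
  -- `A - ev k` annihilates `ef k`, so `u` may be replaced by `ef' k`. Each summand has norm at most
  -- `‖A - B‖`, the second by Weyl.
  have h2 : A u - ev k • u = (A - B) (ef' k) + (ev' k - ev k) • ef' k := by
    rw [hu, map_sub, map_smul, h.eigen, sub_apply, h'.eigen, sub_smul,
      smul_sub, smul_smul, smul_smul, mul_comm c]
    abel
  have h3 : ‖A u - ev k • u‖ ≤ 2 * ‖A - B‖ := by
    rw [h2]
    refine (norm_add_le _ _).trans ?_
    have h4 := (A - B).le_opNorm (ef' k)
    rw [norm_smul, hn', mul_one, Real.norm_eq_abs]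
    rw [hn', mul_one] at h4
    linarith [h.abs_eigenvalue_sub_le h' k]
  have hc1 : c ≤ 1 := by
    have := real_inner_le_norm (ef' k) (ef k)
    rwa [hn, hn', mul_one] at this
  have hu2 : ‖u‖ ^ 2 = 1 - c ^ 2 := by
    rw [hu, @norm_sub_sq_real, inner_smul_right, ← hc, norm_smul, hn, hn']
    simp; ring
  have hd2 : ‖ef' k - ef k‖ ^ 2 = 2 - 2 * c := by
    rw [@norm_sub_sq_real, ← hc, hn, hn']; ring
  -- The sign convention enters here: for `0 ≤ c ≤ 1`, `2(1 - c) ≤ 4(1 - c)(1 + c)`.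
  have hd : ‖ef' k - ef k‖ ≤ 2 * ‖u‖ := by
    refine le_of_sq_le_sq ?_ (by positivity)
    rw [mul_pow, hd2, hu2]
    nlinarith
  nlinarith

end IsDiagonalization

end Perturbation

/-! ### Bilinear forms of kernels and their operators -/

section KernelForm

open scoped ENNReal

/-- Bilinear form `∬ κ(s,s') h(s) f(s') ds ds'` of a kernel on `[0,1]²`. -/
noncomputable def kernelForm (κ : I → I → ℝ) (f h : L2I) : ℝ :=
  ∫ p : I × I, κ p.1 p.2 * (h p.1 * f p.2)

/-- The bilinear form of `κ` is absolutely convergent and bounded. -/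
structure IsBoundedKernel (κ : I → I → ℝ) : Prop where
  integrable : ∀ f h : L2I, Integrable fun p : I × I => κ p.1 p.2 * (h p.1 * f p.2)
  bounded : ∃ C : ℝ, ∀ f h : L2I, |kernelForm κ f h| ≤ C * ‖f‖ * ‖h‖

theorem kernel_congr_add {f₁ f₂ h : L2I} (κ : I → I → ℝ) :
    (fun p : I × I => κ p.1 p.2 * (h p.1 * (f₁ + f₂ : L2I) p.2)) =ᵐ[volume]
      fun p => κ p.1 p.2 * (h p.1 * f₁ p.2) + κ p.1 p.2 * (h p.1 * f₂ p.2) := by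
  have := (Measure.quasiMeasurePreserving_snd (μ := (volume : Measure I))
    (ν := (volume : Measure I))).ae (Lp.coeFn_add f₁ f₂)
  filter_upwards [this] with p hp
  rw [hp]; simp; ring

theorem kernel_congr_add' {f h₁ h₂ : L2I} (κ : I → I → ℝ) :
    (fun p : I × I => κ p.1 p.2 * ((h₁ + h₂ : L2I) p.1 * f p.2)) =ᵐ[volume]
      fun p => κ p.1 p.2 * (h₁ p.1 * f p.2) + κ p.1 p.2 * (h₂ p.1 * f p.2) := by
  have := (Measure.quasiMeasurePreserving_fst (μ := (volume : Measure I))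
    (ν := (volume : Measure I))).ae (Lp.coeFn_add h₁ h₂)
  filter_upwards [this] with p hp
  rw [hp]; simp; ring

theorem kernel_congr_smul {f h : L2I} (c : ℝ) (κ : I → I → ℝ) :
    (fun p : I × I => κ p.1 p.2 * (h p.1 * (c • f : L2I) p.2)) =ᵐ[volume]
      fun p => c * (κ p.1 p.2 * (h p.1 * f p.2)) := by
  have := (Measure.quasiMeasurePreserving_snd (μ := (volume : Measure I))
    (ν := (volume : Measure I))).ae (Lp.coeFn_smul c f)
  filter_upwards [this] with p hp
  rw [hp]; simp; ring

theorem kernel_congr_smul' {f h : L2I} (c : ℝ) (κ : I → I → ℝ) :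
    (fun p : I × I => κ p.1 p.2 * ((c • h : L2I) p.1 * f p.2)) =ᵐ[volume]
      fun p => c * (κ p.1 p.2 * (h p.1 * f p.2)) := by
  have := (Measure.quasiMeasurePreserving_fst (μ := (volume : Measure I))
    (ν := (volume : Measure I))).ae (Lp.coeFn_smul c h)
  filter_upwards [this] with p hp
  rw [hp]; simp; ring

namespace IsBoundedKernel

variable {κ κ' : I → I → ℝ}

theorem exists_operator (hκ : IsBoundedKernel κ) :
    ∃ A : L2I →L[ℝ] L2I, ∀ f h : L2I, inner ℝ h (A f) = kernelForm κ f h := by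
  obtain ⟨C, hC⟩ := hκ.bounded
  let b : L2I →ₗ[ℝ] L2I →ₗ[ℝ] ℝ := LinearMap.mk₂ ℝ (kernelForm κ)
    (fun f₁ f₂ h => by
      unfold kernelForm
      rw [integral_congr_ae (kernel_congr_add κ),
        integral_add (hκ.integrable _ _) (hκ.integrable _ _)])
    (fun c f h => by
      unfold kernelForm
      rw [integral_congr_ae (kernel_congr_smul c κ), integral_const_mul, smul_eq_mul])
    (fun f h₁ h₂ => by
      unfold kernelForm
      rw [integral_congr_ae (kernel_congr_add' κ),
        integral_add (hκ.integrable _ _) (hκ.integrable _ _)])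
    (fun c f h => by
      unfold kernelForm
      rw [integral_congr_ae (kernel_congr_smul' c κ), integral_const_mul, smul_eq_mul])
  let B : L2I →L[ℝ] L2I →L[ℝ] ℝ := b.mkContinuous₂ C hC
  refine ⟨InnerProductSpace.continuousLinearMapOfBilin (𝕜 := ℝ) B, fun f h => ?_⟩
  rw [real_inner_comm, InnerProductSpace.continuousLinearMapOfBilin_apply]
  rfl

theorem kernelForm_eq (hκ : IsBoundedKernel κ) (f h : L2I) :
    kernelForm κ f h = ∫ s : I, h s * ∫ s' : I, κ s s' * f s' := by
  unfold kernelForm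
  have h0 : (volume : Measure (I × I)) = (volume : Measure I).prod volume := rfl
  rw [h0, integral_prod _ (h0 ▸ hκ.integrable f h)]
  refine integral_congr_ae (Eventually.of_forall fun s => ?_)
  simp only
  rw [← integral_const_mul]
  refine integral_congr_ae (Eventually.of_forall fun s' => ?_)
  simp only
  ring

theorem isDiagonalization (hκ : IsBoundedKernel κ) {A : L2I →L[ℝ] L2I}
    (hA : ∀ f h : L2I, inner ℝ h (A f) = kernelForm κ f h) {ev : ℕ → ℝ} {ef : ℕ → L2I}
    (hs : IsSpectralDecomposition κ ev ef) : IsDiagonalization A ev ef where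
  antitone := hs.antitone
  nonneg := hs.nonneg
  orthonormal := hs.orthonormal
  eigen k := by
    refine ext_inner_left ℝ fun h => ?_
    rw [hA, hκ.kernelForm_eq, inner_smul_right, L2.inner_def, ← integral_const_mul]
    refine integral_congr_ae ?_
    filter_upwards [hs.eigen k] with s hs
    rw [hs]
    simp only [RCLike.inner_apply, conj_trivial]
    ring
  complete f hf := by
    refine ext_inner_left ℝ fun h => ?_
    rw [hA, hκ.kernelForm_eq, inner_zero_right, ← integral_zero I ℝ]
    refine integral_congr_ae ?_
    filter_upwards [hs.complete f hf] with s hs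
    rw [hs, mul_zero]

end IsBoundedKernel

theorem ContinuousLinearMap.opNorm_le_of_inner {H : Type*} [NormedAddCommGroup H]
    [InnerProductSpace ℝ H] (A : H →L[ℝ] H) {δ : ℝ} (hδ : 0 ≤ δ)
    (h : ∀ f g, |inner ℝ g (A f)| ≤ δ * ‖f‖ * ‖g‖) : ‖A‖ ≤ δ := by
  refine A.opNorm_le_bound hδ fun f => ?_
  have h1 := h f (A f)
  rw [real_inner_self_eq_norm_sq, abs_of_nonneg (sq_nonneg _), sq] at h1
  rcases (norm_nonneg (A f)).eq_or_lt with h0 | h0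
  · rw [← h0]; positivity
  · exact le_of_mul_le_mul_right h1 h0

/-- Eigenvalues and eigenfunctions of two kernels with close forms are close. -/
theorem spectral_perturbation {κ κ' : I → I → ℝ} (hκ : IsBoundedKernel κ)
    (hκ' : IsBoundedKernel κ') {ev ev' : ℕ → ℝ} {ef ef' : ℕ → L2I}
    (hs : IsSpectralDecomposition κ ev ef) (hs' : IsSpectralDecomposition κ' ev' ef')
    {δ : ℝ} (hδ : 0 ≤ δ)
    (hclose : ∀ f h, |kernelForm κ f h - kernelForm κ' f h| ≤ δ * ‖f‖ * ‖h‖) (k : ℕ) :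
    |ev' k - ev k| ≤ δ ∧ ∀ γ : ℝ, 0 ≤ γ → (∀ i ≠ k, γ ≤ |ev i - ev k|) → γ ≤ ev k →
      0 ≤ inner ℝ (ef' k) (ef k) → γ * ‖ef' k - ef k‖ ≤ 4 * δ := by
  obtain ⟨A, hA⟩ := hκ.exists_operator
  obtain ⟨B, hB⟩ := hκ'.exists_operator
  have hdA := hκ.isDiagonalization hA hs
  have hdB := hκ'.isDiagonalization hB hs'
  have hAB : ‖A - B‖ ≤ δ := (A - B).opNorm_le_of_inner hδ fun f g => by
    rw [sub_apply, inner_sub_right, hA, hB]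
    exact hclose f g
  refine ⟨(hdA.abs_eigenvalue_sub_le hdB k).trans hAB, fun γ h0 h1 h2 h3 => ?_⟩
  exact (hdA.gap_mul_norm_eigenvector_sub_le hdB h0 h1 h2 h3).trans (by linarith)

/-- Needed because the marginal covariance is identified with a second moment kernel only almost
everywhere. -/
theorem IsSpectralDecomposition.congr {κ κ' : I → I → ℝ} {ev : ℕ → ℝ} {ef : ℕ → L2I}
    (h : IsSpectralDecomposition κ ev ef) (hκ : ∀ᵐ s : I, ∀ᵐ s' : I, κ s s' = κ' s s') :
    IsSpectralDecomposition κ' ev ef := by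
  have key : ∀ f : L2I, ∀ᵐ s : I, ∫ s' : I, κ' s s' * f s' = ∫ s' : I, κ s s' * f s' := by
    intro f
    filter_upwards [hκ] with s hs
    refine integral_congr_ae ?_
    filter_upwards [hs] with s' hs'
    rw [hs']
  refine ⟨h.antitone, h.nonneg, h.orthonormal, fun k => ?_, fun f hf => ?_⟩
  · filter_upwards [key (ef k), h.eigen k] with s h1 h2
    rw [h1, h2]
  · filter_upwards [key f, h.complete f hf] with s h1 h2
    rw [h1, h2]

theorem lintegral_mul_le_sqrt_mul_sqrt {α : Type*} [MeasurableSpace α] (μ : Measure α)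
    {f g : α → ℝ≥0∞} (hf : AEMeasurable f μ) (hg : AEMeasurable g μ) :
    ∫⁻ a, f a * g a ∂μ ≤ (∫⁻ a, f a ^ 2 ∂μ) ^ (1 / 2 : ℝ) * (∫⁻ a, g a ^ 2 ∂μ) ^ (1 / 2 : ℝ) := by
  have := ENNReal.lintegral_mul_le_Lp_mul_Lq μ Real.HolderConjugate.two_two hf hg
  simpa using this

theorem L2I_enorm_eq (f : L2I) : (∫⁻ s, ‖f s‖ₑ ^ 2) ^ (1 / 2 : ℝ) = ‖f‖ₑ := by
  rw [Lp.enorm_def, eLpNorm_eq_lintegral_rpow_enorm_toReal (by simp) (by simp)]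
  simp

theorem L2I_enorm_sq_eq (f : L2I) : ∫⁻ s, ‖f s‖ₑ ^ 2 = ‖f‖ₑ ^ 2 := by
  rw [← L2I_enorm_eq, ← ENNReal.rpow_natCast, ← ENNReal.rpow_mul]
  simp

theorem L2I_measurable (f : L2I) : Measurable f := (Lp.stronglyMeasurable f).measurable

/-- Cauchy–Schwarz on the square: the operator norm is at most the Hilbert–Schmidt norm. -/
theorem enorm_kernelForm_le {κ : I → I → ℝ} (hκ : Measurable fun p : I × I => κ p.1 p.2)
    (f h : L2I) : ‖kernelForm κ f h‖ₑ ≤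
      (∫⁻ p : I × I, ‖κ p.1 p.2‖ₑ ^ 2) ^ (1 / 2 : ℝ) * (‖f‖ₑ * ‖h‖ₑ) := by
  have hf := L2I_measurable f
  have hh := L2I_measurable h
  refine (enorm_integral_le_lintegral_enorm _).trans ?_
  simp_rw [enorm_mul]
  refine (lintegral_mul_le_sqrt_mul_sqrt _ (by fun_prop) (by fun_prop)).trans ?_
  refine mul_le_mul_right (le_of_eq ?_) _
  have : ∫⁻ p : I × I, (‖h p.1‖ₑ * ‖f p.2‖ₑ) ^ 2 = ‖h‖ₑ ^ 2 * ‖f‖ₑ ^ 2 := by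
    simp_rw [mul_pow, ← L2I_enorm_sq_eq]
    exact lintegral_prod_mul (μ := volume) (ν := volume) (f := fun s => ‖h s‖ₑ ^ 2)
      (g := fun s => ‖f s‖ₑ ^ 2) (by fun_prop) (by fun_prop)
  rw [this, ← mul_pow, ← ENNReal.rpow_natCast, ← ENNReal.rpow_mul]
  simp [mul_comm]

end KernelForm

/-! ### Second moment kernels and truncation -/

section SecondMoment

open scoped ENNReal

variable {D : Type*} [MeasurableSpace D]

/-- Squared `L²[0,1]` norm of the path of `x` at the sample point `d`. -/
noncomputable def pathEnergy (x : D → I → ℝ) (d : D) : ℝ≥0∞ := ∫⁻ s : I, ‖x d s‖ₑ ^ 2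

/-- Second moment kernel `∫ x(s) x(s') dρ`. -/
noncomputable def secondMoment (x : D → I → ℝ) (ρ : Measure D) (s s' : I) : ℝ :=
  ∫ d, x d s * x d s' ∂ρ

variable {x : D → I → ℝ}

theorem measurable_pathEnergy (hx : Measurable fun p : D × I => x p.1 p.2) :
    Measurable (pathEnergy x) := by
  unfold pathEnergy
  exact Measurable.lintegral_prod_right' (f := fun p : D × I => ‖x p.1 p.2‖ₑ ^ 2) (by fun_prop)

theorem measurable_triple (hx : Measurable fun p : D × I => x p.1 p.2) :
    Measurable fun q : (I × I) × D => x q.2 q.1.1 * x q.2 q.1.2 :=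
  (hx.comp (measurable_snd.prodMk (measurable_fst.comp measurable_fst))).mul
    (hx.comp (measurable_snd.prodMk (measurable_snd.comp measurable_fst)))

theorem measurable_secondMoment (hx : Measurable fun p : D × I => x p.1 p.2) (ρ : Measure D)
    [SFinite ρ] : Measurable fun p : I × I => secondMoment x ρ p.1 p.2 :=
  ((measurable_triple hx).stronglyMeasurable.integral_prod_right').measurable

/-- The kernel of one path has rank one, so the integral factors and Cauchy–Schwarz applies to each
factor. -/
theorem lintegral_pair_le (hx : Measurable fun p : D × I => x p.1 p.2) (f h : L2I) (d : D) :
    ∫⁻ p : I × I, ‖x d p.1 * x d p.2 * (h p.1 * f p.2)‖ₑ ≤ pathEnergy x d * (‖f‖ₑ * ‖h‖ₑ) := by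
  have hf := L2I_measurable f
  have hh := L2I_measurable h
  have hxd : Measurable (x d) := hx.comp measurable_prodMk_left
  have e : ∫⁻ p : I × I, ‖x d p.1 * x d p.2 * (h p.1 * f p.2)‖ₑ
      = (∫⁻ s, ‖x d s‖ₑ * ‖h s‖ₑ) * ∫⁻ s, ‖x d s‖ₑ * ‖f s‖ₑ := by
    rw [← lintegral_prod_mul (by fun_prop) (by fun_prop)]
    refine lintegral_congr fun p => ?_
    simp only [enorm_mul]
    ring
  have c : ∀ f : L2I, ∫⁻ s, ‖x d s‖ₑ * ‖f s‖ₑ ≤ pathEnergy x d ^ (1 / 2 : ℝ) * ‖f‖ₑ := fun f => by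
    have hf := L2I_measurable f
    rw [← L2I_enorm_eq]
    exact lintegral_mul_le_sqrt_mul_sqrt _ (by fun_prop) (by fun_prop)
  rw [e]
  refine (mul_le_mul' (c h) (c f)).trans (le_of_eq ?_)
  have : pathEnergy x d ^ (1 / 2 : ℝ) * pathEnergy x d ^ (1 / 2 : ℝ) = pathEnergy x d := by
    rw [← ENNReal.rpow_add_of_nonneg _ _ (by norm_num) (by norm_num)]
    norm_num
  calc _ = (pathEnergy x d ^ (1 / 2 : ℝ) * pathEnergy x d ^ (1 / 2 : ℝ)) * (‖f‖ₑ * ‖h‖ₑ) := by ring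
    _ = _ := by rw [this]

theorem integrable_triple (hx : Measurable fun p : D × I => x p.1 p.2) (ρ : Measure D) [SFinite ρ]
    (hρ : ∫⁻ d, pathEnergy x d ∂ρ ≠ ⊤) (f h : L2I) :
    Integrable (fun q : (I × I) × D => x q.2 q.1.1 * x q.2 q.1.2 * (h q.1.1 * f q.1.2))
      ((volume : Measure (I × I)).prod ρ) := by
  have hf := L2I_measurable f
  have hh := L2I_measurable h
  have hm : Measurable
      fun q : (I × I) × D => x q.2 q.1.1 * x q.2 q.1.2 * (h q.1.1 * f q.1.2) :=
    (measurable_triple hx).mul (by fun_prop)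
  refine ⟨hm.aestronglyMeasurable, ?_⟩
  rw [HasFiniteIntegral, lintegral_prod_symm _ hm.enorm.aemeasurable]
  refine (lintegral_mono (lintegral_pair_le hx f h)).trans_lt ?_
  rw [lintegral_mul_const _ (measurable_pathEnergy hx)]
  exact ENNReal.mul_lt_top hρ.lt_top (ENNReal.mul_lt_top enorm_lt_top enorm_lt_top)

theorem kernelForm_secondMoment (hx : Measurable fun p : D × I => x p.1 p.2) (ρ : Measure D)
    [SFinite ρ] (hρ : ∫⁻ d, pathEnergy x d ∂ρ ≠ ⊤) (f h : L2I) :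
    kernelForm (secondMoment x ρ) f h =
      ∫ d, (∫ p : I × I, x d p.1 * x d p.2 * (h p.1 * f p.2)) ∂ρ := by
  rw [integral_integral_swap (f := fun d (p : I × I) => x d p.1 * x d p.2 * (h p.1 * f p.2))
    (integrable_triple hx ρ hρ f h).swap]
  simp only [integral_mul_const]
  rfl

/-- The form is an average of rank-one forms. Unlike a variance bound, this costs only one power of
the energy, which makes it usable for the untruncated tails. -/
theorem enorm_kernelForm_secondMoment_le (hx : Measurable fun p : D × I => x p.1 p.2)
    (ρ : Measure D) [SFinite ρ] (hρ : ∫⁻ d, pathEnergy x d ∂ρ ≠ ⊤) (f h : L2I) :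
    ‖kernelForm (secondMoment x ρ) f h‖ₑ ≤ (∫⁻ d, pathEnergy x d ∂ρ) * (‖f‖ₑ * ‖h‖ₑ) := by
  rw [kernelForm_secondMoment hx ρ hρ, ← lintegral_mul_const _ (measurable_pathEnergy hx)]
  refine (enorm_integral_le_lintegral_enorm _).trans (lintegral_mono fun d => ?_)
  exact (enorm_integral_le_lintegral_enorm _).trans (lintegral_pair_le hx f h d)

theorem isBoundedKernel_secondMoment (hx : Measurable fun p : D × I => x p.1 p.2)
    (ρ : Measure D) [SFinite ρ] (hρ : ∫⁻ d, pathEnergy x d ∂ρ ≠ ⊤) :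
    IsBoundedKernel (secondMoment x ρ) where
  integrable f h := by
    have := (integrable_triple hx ρ hρ f h).integral_prod_left
    simp only [integral_mul_const] at this
    exact this
  bounded := by
    refine ⟨(∫⁻ d, pathEnergy x d ∂ρ).toReal, fun f h => ?_⟩
    have h1 := enorm_kernelForm_secondMoment_le hx ρ hρ f h
    have h2 := ENNReal.toReal_mono
      (ENNReal.mul_ne_top hρ (ENNReal.mul_ne_top enorm_ne_top enorm_ne_top)) h1
    simpa [ENNReal.toReal_mul, mul_assoc] using h2

theorem kernelForm_secondMoment_split (hx : Measurable fun p : D × I => x p.1 p.2)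
    (ρ : Measure D) [SFinite ρ] (hρ : ∫⁻ d, pathEnergy x d ∂ρ ≠ ⊤) {G : Set D}
    (hG : MeasurableSet G) (f h : L2I) :
    kernelForm (secondMoment x ρ) f h = kernelForm (secondMoment x (ρ.restrict G)) f h +
      kernelForm (secondMoment x (ρ.restrict Gᶜ)) f h := by
  have hle : ∀ S : Set D, ∫⁻ d, pathEnergy x d ∂(ρ.restrict S) ≠ ⊤ := fun S =>
    ((lintegral_mono' Measure.restrict_le_self le_rfl).trans_lt hρ.lt_top).ne
  rw [kernelForm_secondMoment hx ρ hρ, kernelForm_secondMoment hx _ (hle _),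
    kernelForm_secondMoment hx _ (hle _)]
  exact (integral_add_compl hG (integrable_triple hx ρ hρ f h).integral_prod_right).symm

/-- Comparison of two second moment kernels by truncation to `G`. -/
theorem enorm_kernelForm_sub_le (hx : Measurable fun p : D × I => x p.1 p.2)
    (ρ ρ' : Measure D) [SFinite ρ] [SFinite ρ'] (hρ : ∫⁻ d, pathEnergy x d ∂ρ ≠ ⊤)
    (hρ' : ∫⁻ d, pathEnergy x d ∂ρ' ≠ ⊤) {G : Set D} (hG : MeasurableSet G) (f h : L2I) :
    ‖kernelForm (secondMoment x ρ) f h - kernelForm (secondMoment x ρ') f h‖ₑ ≤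
      ((∫⁻ p : I × I, ‖secondMoment x (ρ.restrict G) p.1 p.2 -
          secondMoment x (ρ'.restrict G) p.1 p.2‖ₑ ^ 2) ^ (1 / 2 : ℝ) +
        (∫⁻ d in Gᶜ, pathEnergy x d ∂ρ) + ∫⁻ d in Gᶜ, pathEnergy x d ∂ρ') * (‖f‖ₑ * ‖h‖ₑ) := by
  have hle : ∀ S : Set D, ∫⁻ d, pathEnergy x d ∂(ρ.restrict S) ≠ ⊤ := fun S =>
    ((lintegral_mono' Measure.restrict_le_self le_rfl).trans_lt hρ.lt_top).ne
  have hle' : ∀ S : Set D, ∫⁻ d, pathEnergy x d ∂(ρ'.restrict S) ≠ ⊤ := fun S =>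
    ((lintegral_mono' Measure.restrict_le_self le_rfl).trans_lt hρ'.lt_top).ne
  have e : kernelForm (secondMoment x (ρ.restrict G)) f h -
      kernelForm (secondMoment x (ρ'.restrict G)) f h =
      kernelForm (fun s s' => secondMoment x (ρ.restrict G) s s' -
        secondMoment x (ρ'.restrict G) s s') f h := by
    unfold kernelForm
    rw [← integral_sub ((isBoundedKernel_secondMoment hx _ (hle G)).integrable f h)
      ((isBoundedKernel_secondMoment hx _ (hle' G)).integrable f h)]
    simp only [sub_mul]
  have hd : kernelForm (secondMoment x ρ) f h - kernelForm (secondMoment x ρ') f h =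
      (kernelForm (fun s s' => secondMoment x (ρ.restrict G) s s' -
        secondMoment x (ρ'.restrict G) s s') f h +
      kernelForm (secondMoment x (ρ.restrict Gᶜ)) f h) -
      kernelForm (secondMoment x (ρ'.restrict Gᶜ)) f h := by
    rw [kernelForm_secondMoment_split hx ρ hρ hG, kernelForm_secondMoment_split hx ρ' hρ' hG, ← e]
    ring
  rw [hd, add_mul, add_mul]
  refine enorm_sub_le.trans (add_le_add ((enorm_add_le _ _).trans (add_le_add ?_ ?_)) ?_)
  · exact enorm_kernelForm_le
      ((measurable_secondMoment hx _).sub (measurable_secondMoment hx _)) f h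
  · exact enorm_kernelForm_secondMoment_le hx _ (hle _) f h
  · exact enorm_kernelForm_secondMoment_le hx _ (hle' _) f h

end SecondMoment

/-! ### The empirical measure of the pooled sample -/

section Empirical

open scoped ENNReal

variable {D Ω : Type*} [MeasurableSpace D]

/-- The empirical measure of the pooled sample `V i j`, `i < n`, `j < m i`. -/
noncomputable def empirical (m : ℕ → ℕ) (V : ℕ → ℕ → Ω → D) (n : ℕ) (ω : Ω) : Measure D :=
  (ENNReal.ofReal (∑ i ∈ Finset.range n, (m i : ℝ)))⁻¹ •
    ∑ i ∈ Finset.range n, ∑ j ∈ Finset.range (m i), Measure.dirac (V i j ω)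

instance (m : ℕ → ℕ) (V : ℕ → ℕ → Ω → D) (n : ℕ) (ω : Ω) : SFinite (empirical m V n ω) := by
  have : SFinite (∑ i ∈ Finset.range n, ∑ j ∈ Finset.range (m i), Measure.dirac (V i j ω)) := by
    infer_instance
  unfold empirical
  infer_instance

theorem integral_empirical (m : ℕ → ℕ) (V : ℕ → ℕ → Ω → D) (n : ℕ) (ω : Ω) {z : D → ℝ}
    (hz : Measurable z) : ∫ d, z d ∂(empirical m V n ω) =
      (∑ i ∈ Finset.range n, ∑ j ∈ Finset.range (m i), z (V i j ω)) /
        ∑ i ∈ Finset.range n, (m i : ℝ) := by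
  have hd : ∀ d, Integrable z (Measure.dirac d) := fun d =>
    integrable_dirac' hz.stronglyMeasurable enorm_lt_top
  rw [empirical, integral_smul_measure, integral_finsetSum_measure
    (fun i _ => integrable_finsetSum_measure.2 fun j _ => hd _)]
  simp_rw [integral_finsetSum_measure (fun j (_ : j ∈ Finset.range _) => hd _),
    integral_dirac' z _ hz.stronglyMeasurable]
  -- If the total is `0`, the weight `⊤` has real part `0`, in agreement with division by zero.
  rw [ENNReal.toReal_inv, ENNReal.toReal_ofReal (Finset.sum_nonneg fun _ _ => Nat.cast_nonneg _),
    smul_eq_mul, div_eq_inv_mul]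

theorem lintegral_empirical (m : ℕ → ℕ) (V : ℕ → ℕ → Ω → D) (n : ℕ) (ω : Ω) {z : D → ℝ≥0∞}
    (hz : Measurable z) : ∫⁻ d, z d ∂(empirical m V n ω) =
      (ENNReal.ofReal (∑ i ∈ Finset.range n, (m i : ℝ)))⁻¹ *
        ∑ i ∈ Finset.range n, ∑ j ∈ Finset.range (m i), z (V i j ω) := by
  rw [empirical, lintegral_smul_measure, lintegral_finsetSum_measure]
  simp_rw [lintegral_finsetSum_measure, lintegral_dirac' _ hz, smul_eq_mul]

theorem secondMoment_empirical {x : D → I → ℝ} (hx : Measurable fun p : D × I => x p.1 p.2)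
    (m : ℕ → ℕ) (V : ℕ → ℕ → Ω → D) (n : ℕ) (ω : Ω) :
    secondMoment x (empirical m V n ω) = sampleCov m (fun i j s => x (V i j ω) s) n := by
  funext s s'
  exact integral_empirical m V n ω
    ((hx.comp (measurable_id.prodMk measurable_const)).mul
      (hx.comp (measurable_id.prodMk measurable_const)))

variable [MeasurableSpace Ω] {μ : Measure Ω} {ν : Measure D} {m : ℕ → ℕ} {V : ℕ → ℕ → Ω → D} {n : ℕ}

/-- Pooled means are unbiased by linearity alone, whatever the dependence between observations. -/
theorem lintegral_lintegral_empirical (hV : ∀ i j, Measurable (V i j))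
    (hlaw : ∀ i j, μ.map (V i j) = ν) (hm : 0 < ∑ i ∈ Finset.range n, (m i : ℝ))
    {z : D → ℝ≥0∞} (hz : Measurable z) :
    ∫⁻ ω, ∫⁻ d, z d ∂(empirical m V n ω) ∂μ = ∫⁻ d, z d ∂ν := by
  simp_rw [lintegral_empirical m V n _ hz]
  rw [lintegral_const_mul _ (by fun_prop), lintegral_finsetSum _ (by fun_prop)]
  have h1 : ∀ i j, ∫⁻ ω, z (V i j ω) ∂μ = ∫⁻ d, z d ∂ν := fun i j => by
    rw [← hlaw i j, lintegral_map hz (hV i j)]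
  have h2 : ∀ i, ∫⁻ ω, ∑ j ∈ Finset.range (m i), z (V i j ω) ∂μ = m i * ∫⁻ d, z d ∂ν := fun i => by
    rw [lintegral_finsetSum _ (by fun_prop)]
    simp [h1]
  simp_rw [h2]
  rw [← Finset.sum_mul, ← mul_assoc, ENNReal.ofReal_sum_of_nonneg (fun _ _ => Nat.cast_nonneg _)]
  simp only [ENNReal.ofReal_natCast]
  rw [ENNReal.inv_mul_cancel, one_mul]
  · intro h0
    have : (∑ i ∈ Finset.range n, (m i : ℝ)) = 0 := by exact_mod_cast h0
    exact hm.ne' this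
  · exact_mod_cast ENNReal.natCast_ne_top (∑ i ∈ Finset.range n, m i)

/-- Mean square error of a pooled mean of subjects that are independent of each other. -/
theorem lintegral_enorm_empirical_sub_sq_le [IsProbabilityMeasure μ]
    (hV : ∀ i j, Measurable (V i j)) (hlaw : ∀ i j, μ.map (V i j) = ν)
    (hind : Pairwise fun i i' => IndepFun (fun ω j => V i j ω) (fun ω j => V i' j ω) μ)
    (hm : 0 < ∑ i ∈ Finset.range n, (m i : ℝ))
    {z : D → ℝ} (hz : Measurable z) (hz2 : MemLp z 2 ν) :
    ∫⁻ ω, ‖∫ d, z d ∂(empirical m V n ω) - ∫ d, z d ∂ν‖ₑ ^ 2 ∂μ ≤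
      ENNReal.ofReal ((∑ i ∈ Finset.range n, (m i : ℝ) ^ 2) /
        (∑ i ∈ Finset.range n, (m i : ℝ)) ^ 2) * ∫⁻ d, ‖z d‖ₑ ^ 2 ∂ν := by
  set N : ℝ := ∑ i ∈ Finset.range n, (m i : ℝ) with hN
  set S : ℕ → Ω → ℝ := fun i ω => ∑ j ∈ Finset.range (m i), z (V i j ω) with hS
  have : IsProbabilityMeasure ν := hlaw 0 0 ▸ Measure.isProbabilityMeasure_map (hV 0 0).aemeasurable
  have hzV : ∀ i j, MemLp (fun ω => z (V i j ω)) 2 μ := fun i j =>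
    (memLp_map_measure_iff hz.aestronglyMeasurable (hV i j).aemeasurable).1
      ((hlaw i j).symm ▸ hz2)
  have hSm : ∀ i, Measurable (S i) := fun i => by fun_prop
  have hSL : ∀ i, MemLp (S i) 2 μ := fun i => memLp_finsetSum _ fun j _ => hzV i j
  have hint : ∀ i j, ∫ ω, z (V i j ω) ∂μ = ∫ d, z d ∂ν := fun i j => by
    rw [← hlaw i j, integral_map (hV i j).aemeasurable hz.aestronglyMeasurable]
  have hint2 : ∀ i j, ∫ ω, z (V i j ω) ^ 2 ∂μ = ∫ d, z d ^ 2 ∂ν := fun i j => by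
    rw [← hlaw i j, integral_map (hV i j).aemeasurable (by fun_prop)]
  set A : Ω → ℝ := fun ω => N⁻¹ * (∑ i ∈ Finset.range n, S i) ω with hA
  have hemp : ∀ ω, ∫ d, z d ∂(empirical m V n ω) = A ω := fun ω => by
    simp only [integral_empirical m V n ω hz, hA, div_eq_inv_mul, Finset.sum_apply, hN, hS]
  have hAL : MemLp A 2 μ := (memLp_finsetSum' _ fun i _ => hSL i).const_mul _
  have hmean : ∫ ω, A ω ∂μ = ∫ d, z d ∂ν := by
    simp only [hA, Finset.sum_apply, hS]
    rw [integral_const_mul, integral_finsetSum _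
      (fun i _ => integrable_finsetSum _ fun j _ => (hzV i j).integrable (by norm_num))]
    simp_rw [integral_finsetSum _ (fun j (_ : j ∈ Finset.range _) =>
      (hzV _ j).integrable (by norm_num)), hint]
    simp only [Finset.sum_const, Finset.card_range, nsmul_eq_mul]
    rw [← Finset.sum_mul, ← hN, ← mul_assoc, inv_mul_cancel₀ hm.ne', one_mul]
  -- Visits of one subject may be arbitrarily dependent; Cauchy–Schwarz over them costs the factor
  -- `(m i) ^ 2`.
  have hvarS : ∀ i, variance (S i) μ ≤ (m i : ℝ) ^ 2 * ∫ d, z d ^ 2 ∂ν := fun i => by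
    refine (variance_le_expectation_sq (hSm i).aestronglyMeasurable).trans ?_
    have hle : ∀ ω, (S i ^ 2) ω ≤ m i * ∑ j ∈ Finset.range (m i), z (V i j ω) ^ 2 := fun ω => by
      have := sq_sum_le_card_mul_sum_sq (s := Finset.range (m i)) (f := fun j => z (V i j ω))
      simpa using this
    have hsqi : ∀ j, Integrable (fun ω => z (V i j ω) ^ 2) μ := fun j => (hzV i j).integrable_sq
    refine (integral_mono (hSL i).integrable_sq
      ((integrable_finsetSum _ fun j _ => hsqi j).const_mul _) hle).trans (le_of_eq ?_)
    rw [integral_const_mul, integral_finsetSum _ fun j _ => hsqi j]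
    simp only [hint2, Finset.sum_const, Finset.card_range, nsmul_eq_mul]
    ring
  have hvar : variance A μ ≤
      ((∑ i ∈ Finset.range n, (m i : ℝ) ^ 2) / N ^ 2) * ∫ d, z d ^ 2 ∂ν := by
    rw [hA, variance_const_mul, IndepFun.variance_sum (fun i _ => hSL i)]
    · have := Finset.sum_le_sum fun i (_ : i ∈ Finset.range n) => hvarS i
      rw [← Finset.sum_mul] at this
      calc _ ≤ N⁻¹ ^ 2 * ((∑ i ∈ Finset.range n, (m i : ℝ) ^ 2) * ∫ d, z d ^ 2 ∂ν) :=
            mul_le_mul_of_nonneg_left this (by positivity)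
        _ = _ := by rw [inv_pow]; ring
    · intro i _ i' _ hii
      exact (hind hii).comp (φ := fun v : ℕ → D => ∑ j ∈ Finset.range (m i), z (v j))
        (ψ := fun v : ℕ → D => ∑ j ∈ Finset.range (m i'), z (v j)) (by fun_prop) (by fun_prop)
  have hzz : ENNReal.ofReal (∫ d, z d ^ 2 ∂ν) = ∫⁻ d, ‖z d‖ₑ ^ 2 ∂ν := by
    rw [ofReal_integral_eq_lintegral_ofReal hz2.integrable_sq
      (Eventually.of_forall fun _ => sq_nonneg _)]
    refine lintegral_congr fun d => ?_
    rw [← sq_abs, ENNReal.ofReal_pow (abs_nonneg _), Real.enorm_eq_ofReal_abs]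
  calc ∫⁻ ω, ‖∫ d, z d ∂(empirical m V n ω) - ∫ d, z d ∂ν‖ₑ ^ 2 ∂μ = evariance A μ := by
        simp_rw [hemp, evariance, hmean]
    _ = ENNReal.ofReal (variance A μ) := hAL.ofReal_variance_eq.symm
    _ ≤ _ := ENNReal.ofReal_le_ofReal hvar
    _ = _ := by rw [ENNReal.ofReal_mul (by positivity), hzz]

variable {x : D → I → ℝ}

theorem secondMoment_restrict (ρ : Measure D) {G : Set D} (hG : MeasurableSet G) (s s' : I) :
    secondMoment x (ρ.restrict G) s s' = ∫ d, G.indicator (fun d => x d s * x d s') d ∂ρ :=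
  (integral_indicator hG).symm

theorem measurable_secondMoment_empirical_restrict (hx : Measurable fun p : D × I => x p.1 p.2)
    (hV : ∀ i j, Measurable (V i j)) {G : Set D} (hG : MeasurableSet G) :
    Measurable fun q : Ω × (I × I) =>
      secondMoment x ((empirical m V n q.1).restrict G) q.2.1 q.2.2 := by
  have hz : Measurable ((Prod.snd ⁻¹' G).indicator
      fun q : (I × I) × D => x q.2 q.1.1 * x q.2 q.1.2) :=
    (measurable_triple hx).indicator (measurable_snd hG)
  have hzp : ∀ p : I × I, Measurable (G.indicator fun d => x d p.1 * x d p.2) :=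
    fun p => hz.comp (measurable_prodMk_left (x := p))
  simp_rw [secondMoment_restrict _ hG, integral_empirical m V n _ (hzp _)]
  exact (Finset.measurable_fun_sum _ fun i _ => Finset.measurable_fun_sum _ fun j _ =>
    hz.comp (measurable_snd.prodMk ((hV i j).comp measurable_fst))).div_const _

/-- By Tonelli the variance bound is applied at each `(s, s')` and then integrated; the squared
truncated product integrates over the square to the squared energy on `G`, hence at most `M ^ 2`. -/
theorem lintegral_secondMoment_sub_le [IsProbabilityMeasure μ]
    (hx : Measurable fun p : D × I => x p.1 p.2)
    (hV : ∀ i j, Measurable (V i j)) (hlaw : ∀ i j, μ.map (V i j) = ν)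
    (hind : Pairwise fun i i' => IndepFun (fun ω j => V i j ω) (fun ω j => V i' j ω) μ)
    (hm : 0 < ∑ i ∈ Finset.range n, (m i : ℝ)) (M : ℕ) :
    ∫⁻ ω, (∫⁻ p : I × I, ‖secondMoment x ((empirical m V n ω).restrict
        {d | pathEnergy x d ≤ M}) p.1 p.2 -
        secondMoment x (ν.restrict {d | pathEnergy x d ≤ M}) p.1 p.2‖ₑ ^ 2) ∂μ ≤
      ENNReal.ofReal ((∑ i ∈ Finset.range n, (m i : ℝ) ^ 2) /
        (∑ i ∈ Finset.range n, (m i : ℝ)) ^ 2) * M ^ 2 := by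
  have : IsProbabilityMeasure ν := hlaw 0 0 ▸ Measure.isProbabilityMeasure_map (hV 0 0).aemeasurable
  set G : Set D := {d | pathEnergy x d ≤ M} with hGdef
  have hG : MeasurableSet G := measurableSet_le (measurable_pathEnergy hx) measurable_const
  let z : (I × I) × D → ℝ := (Prod.snd ⁻¹' G).indicator fun q => x q.2 q.1.1 * x q.2 q.1.2
  have hz : Measurable z := (measurable_triple hx).indicator (measurable_snd hG)
  have hzp : ∀ p : I × I, Measurable fun d => z (p, d) := fun p => hz.comp measurable_prodMk_left
  have hsec : ∀ (ρ : Measure D) (p : I × I),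
      secondMoment x (ρ.restrict G) p.1 p.2 = ∫ d, z (p, d) ∂ρ := fun ρ p =>
    secondMoment_restrict ρ hG p.1 p.2
  have hmeas : Measurable fun q : Ω × (I × I) =>
      ‖secondMoment x ((empirical m V n q.1).restrict G) q.2.1 q.2.2 -
        secondMoment x (ν.restrict G) q.2.1 q.2.2‖ₑ ^ 2 :=
    ((measurable_secondMoment_empirical_restrict hx hV hG).sub
      ((measurable_secondMoment hx _).comp measurable_snd)).enorm.pow_const 2
  rw [lintegral_lintegral_swap hmeas.aemeasurable]
  simp_rw [hsec]
  have hzsq : ∫⁻ p : I × I, (∫⁻ d, ‖z (p, d)‖ₑ ^ 2 ∂ν) ≤ M ^ 2 := by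
    rw [lintegral_lintegral_swap (f := fun p d => ‖z (p, d)‖ₑ ^ 2)
      (hz.enorm.pow_const 2).aemeasurable]
    have hd : ∀ d, ∫⁻ p : I × I, ‖z (p, d)‖ₑ ^ 2 ≤ M ^ 2 := fun d => by
      by_cases h : d ∈ G
      · have hxd : Measurable (x d) := hx.comp measurable_prodMk_left
        calc ∫⁻ p : I × I, ‖z (p, d)‖ₑ ^ 2
            = ∫⁻ p : I × I, ‖x d p.1‖ₑ ^ 2 * ‖x d p.2‖ₑ ^ 2 := by
              refine lintegral_congr fun p => ?_
              simp only [z]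
              rw [Set.indicator_of_mem (by exact h), enorm_mul, mul_pow]
          _ = pathEnergy x d * pathEnergy x d :=
              lintegral_prod_mul (μ := volume) (ν := volume) (f := fun s => ‖x d s‖ₑ ^ 2)
                (g := fun s => ‖x d s‖ₑ ^ 2) (by fun_prop) (by fun_prop)
          _ ≤ M ^ 2 := by rw [sq]; exact mul_le_mul' h h
      · have : ∀ p, z (p, d) = 0 := fun p => Set.indicator_of_notMem (by exact h) _
        simp [this]
    refine (lintegral_mono hd).trans ?_
    simp
  -- Truncation bounds the norm of a path, not its values, so square integrability holds only for
  -- almost every `(s, s')`.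
  have hfin : ∀ᵐ p : I × I, ∫⁻ d, ‖z (p, d)‖ₑ ^ 2 ∂ν < ⊤ :=
    ae_lt_top ((hz.enorm.pow_const 2).lintegral_prod_right')
      (hzsq.trans_lt (by simp)).ne
  calc _ ≤ ∫⁻ p : I × I, ENNReal.ofReal ((∑ i ∈ Finset.range n, (m i : ℝ) ^ 2) /
        (∑ i ∈ Finset.range n, (m i : ℝ)) ^ 2) * ∫⁻ d, ‖z (p, d)‖ₑ ^ 2 ∂ν := by
        refine lintegral_mono_ae ?_
        filter_upwards [hfin] with p hp
        refine lintegral_enorm_empirical_sub_sq_le hV hlaw hind hm (hzp p) ?_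
        refine ⟨(hzp p).aestronglyMeasurable, ?_⟩
        rw [eLpNorm_lt_top_iff_lintegral_rpow_enorm_lt_top (by simp) (by simp)]
        simpa using hp
    _ = _ * ∫⁻ p : I × I, ∫⁻ d, ‖z (p, d)‖ₑ ^ 2 ∂ν :=
        lintegral_const_mul _ ((hz.enorm.pow_const 2).lintegral_prod_right')
    _ ≤ _ := mul_le_mul_right hzsq _

end Empirical

/-! ### Weak law of large numbers in operator norm -/

section Consistency

open scoped ENNReal

variable {D Ω : Type*} [MeasurableSpace D] [MeasurableSpace Ω] {μ : Measure Ω} {ν : Measure D}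
  {m : ℕ → ℕ} {V : ℕ → ℕ → Ω → D} {x : D → I → ℝ}

/-- Markov's inequality makes the tail sets small; absolute continuity of the integral does the
rest. -/
theorem tendsto_setLIntegral_tail {f : D → ℝ≥0∞} (hf : Measurable f) (h : ∫⁻ d, f d ∂ν ≠ ⊤) :
    Tendsto (fun M : ℕ => ∫⁻ d in {d | f d ≤ M}ᶜ, f d ∂ν) atTop (𝓝 0) := by
  refine tendsto_setLIntegral_zero h ?_
  have h1 : Tendsto (fun M : ℕ => (∫⁻ d, f d ∂ν) * (M : ℝ≥0∞)⁻¹) atTop (𝓝 0) := by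
    have := ENNReal.Tendsto.const_mul (a := ∫⁻ d, f d ∂ν) ENNReal.tendsto_inv_nat_nhds_zero
      (Or.inr h)
    simpa using this
  refine tendsto_of_tendsto_of_tendsto_of_le_of_le' tendsto_const_nhds h1
    (Eventually.of_forall fun _ => zero_le) ?_
  filter_upwards [eventually_ge_atTop 1] with M hM
  have hM0 : (M : ℝ≥0∞) ≠ 0 := by exact_mod_cast (by omega : M ≠ 0)
  calc ν {d | f d ≤ M}ᶜ ≤ ν {d | (M : ℝ≥0∞) ≤ f d} :=
        measure_mono fun d (hd : ¬ f d ≤ M) => (not_le.1 hd).le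
    _ ≤ (∫⁻ d, f d ∂ν) / M :=
        meas_ge_le_lintegral_div hf.aemeasurable hM0 (ENNReal.natCast_ne_top _)
    _ = _ := div_eq_mul_inv _ _

theorem lintegral_empirical_ne_top_ae (hV : ∀ i j, Measurable (V i j))
    (hlaw : ∀ i j, μ.map (V i j) = ν) {n : ℕ} (hm : 0 < ∑ i ∈ Finset.range n, (m i : ℝ))
    {z : D → ℝ≥0∞} (hz : Measurable z) (h : ∫⁻ d, z d ∂ν ≠ ⊤) :
    ∀ᵐ ω ∂μ, ∫⁻ d, z d ∂(empirical m V n ω) ≠ ⊤ := by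
  have h1 : Measurable fun ω => ∫⁻ d, z d ∂(empirical m V n ω) := by
    simp_rw [lintegral_empirical m V n _ hz]
    fun_prop
  have h2 := ae_lt_top h1 (by rw [lintegral_lintegral_empirical hV hlaw hm hz]; exact h)
  filter_upwards [h2] with ω hω using hω.ne

theorem abs_le_of_enorm_le {a δ : ℝ} {b c : L2I} {K : ℝ≥0∞} (hδ : 0 ≤ δ)
    (h : ‖a‖ₑ ≤ K * (‖b‖ₑ * ‖c‖ₑ)) (hK : K ≤ ENNReal.ofReal δ) : |a| ≤ δ * ‖b‖ * ‖c‖ := by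
  have h1 := h.trans (mul_le_mul_left hK (‖b‖ₑ * ‖c‖ₑ))
  have h2 := ENNReal.toReal_mono (ENNReal.mul_ne_top ENNReal.ofReal_ne_top
    (ENNReal.mul_ne_top enorm_ne_top enorm_ne_top)) h1
  simpa [ENNReal.toReal_mul, mul_assoc, ENNReal.toReal_ofReal hδ] using h2

/-- Weak law of large numbers for the form of the second moment kernel, in operator norm, for
clustered data with sparse cluster sizes `m`. -/
theorem tendsto_measure_kernelForm_empirical [IsProbabilityMeasure μ]
    (hx : Measurable fun p : D × I => x p.1 p.2) (hν : ∫⁻ d, pathEnergy x d ∂ν ≠ ⊤)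
    (hV : ∀ i j, Measurable (V i j)) (hlaw : ∀ i j, μ.map (V i j) = ν)
    (hind : Pairwise fun i i' => IndepFun (fun ω j => V i j ω) (fun ω j => V i' j ω) μ)
    (hm1 : ∀ i, 1 ≤ m i)
    (hm : Tendsto (fun n => (∑ i ∈ Finset.range n, (m i : ℝ) ^ 2) /
      (∑ i ∈ Finset.range n, (m i : ℝ)) ^ 2) atTop (𝓝 0)) {δ : ℝ} (hδ : 0 < δ) :
    Tendsto (fun n => μ {ω | ¬ ∀ f h : L2I,
      |kernelForm (secondMoment x ν) f h - kernelForm (secondMoment x (empirical m V n ω)) f h| ≤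
        δ * ‖f‖ * ‖h‖}) atTop (𝓝 0) := by
  have : IsProbabilityMeasure ν := hlaw 0 0 ▸ Measure.isProbabilityMeasure_map (hV 0 0).aemeasurable
  set c : ℕ → ℝ≥0∞ := fun n => ENNReal.ofReal ((∑ i ∈ Finset.range n, (m i : ℝ) ^ 2) /
      (∑ i ∈ Finset.range n, (m i : ℝ)) ^ 2) with hc
  have hc0 : Tendsto c atTop (𝓝 0) := by
    -- The hypothesis `hm` on the cluster sizes is transported to extended nonnegative reals.
    rw [← ENNReal.ofReal_zero]
    exact (ENNReal.continuous_ofReal.tendsto 0).comp hm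
  -- One third of `δ` for each error: truncated kernels, empirical tail, tail under `ν`.
  set a : ℝ≥0∞ := ENNReal.ofReal (δ / 3) with ha
  have ha0 : a ≠ 0 := by simpa [ha] using hδ
  have hat : a ≠ ⊤ := ENNReal.ofReal_ne_top
  have haaa : a + a + a ≤ ENNReal.ofReal δ := by
    rw [ha, ← ENNReal.ofReal_add (by positivity) (by positivity),
      ← ENNReal.ofReal_add (by positivity) (by positivity)]
    exact ENNReal.ofReal_le_ofReal (by linarith)
  have hE := measurable_pathEnergy hx
  rw [ENNReal.tendsto_nhds_zero]
  intro ε hε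
  have hε2 : 0 < ε / 2 := ENNReal.half_pos hε.ne'
  -- `M` is fixed before `n`. The first bound handles the tail under `ν`; the second lets Markov
  -- bound by `ε / 2` the probability that the empirical tail reaches `a`.
  obtain ⟨M, hMa, hMε⟩ := (((ENNReal.tendsto_nhds_zero.1 (tendsto_setLIntegral_tail hE hν)) a
    (pos_iff_ne_zero.2 ha0)).and ((ENNReal.tendsto_nhds_zero.1 (tendsto_setLIntegral_tail hE hν))
      (a * (ε / 2)) (ENNReal.mul_pos ha0 hε2.ne'))).exists
  have hcM : Tendsto (fun n => c n * ((M : ℝ≥0∞) ^ 2 / a ^ 2)) atTop (𝓝 0) := by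
    have := ENNReal.Tendsto.mul_const (b := (M : ℝ≥0∞) ^ 2 / a ^ 2) hc0
      (Or.inr (ENNReal.div_ne_top (by simp) (by simpa using ha0)))
    simpa using this
  filter_upwards [(ENNReal.tendsto_nhds_zero.1 hcM) _ hε2, eventually_ge_atTop 1] with n hn hn1
  have hm0 : 0 < ∑ i ∈ Finset.range n, (m i : ℝ) :=
    Finset.sum_pos (fun i _ => by exact_mod_cast hm1 i) ⟨0, Finset.mem_range.2 hn1⟩
  set G : Set D := {d | pathEnergy x d ≤ M} with hGdef
  have hG : MeasurableSet G := measurableSet_le hE measurable_const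
  set W : Ω → ℝ≥0∞ := fun ω => ∫⁻ p : I × I, ‖secondMoment x ((empirical m V n ω).restrict G) p.1 p.2 -
    secondMoment x (ν.restrict G) p.1 p.2‖ₑ ^ 2 with hW
  set R : Ω → ℝ≥0∞ := fun ω => ∫⁻ d in Gᶜ, pathEnergy x d ∂(empirical m V n ω) with hR
  have hRW : μ {ω | a ^ 2 ≤ W ω} ≤ ε / 2 := by
    have h1 := lintegral_secondMoment_sub_le (n := n) hx hV hlaw hind hm0 M
    refine le_trans ?_ hn
    have hWm : Measurable W := Measurable.lintegral_prod_right'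
      (((measurable_secondMoment_empirical_restrict hx hV hG).sub
        ((measurable_secondMoment hx _).comp measurable_snd)).enorm.pow_const 2)
    calc μ {ω | a ^ 2 ≤ W ω} ≤ (∫⁻ ω, W ω ∂μ) / a ^ 2 :=
          meas_ge_le_lintegral_div hWm.aemeasurable (by simpa using ha0) (by simpa using hat)
      _ ≤ (c n * M ^ 2) / a ^ 2 := by
          exact ENNReal.div_le_div_right h1 _
      _ = _ := by rw [mul_div_assoc]
  have hRR : μ {ω | a ≤ R ω} ≤ ε / 2 := by
    have hRe : ∀ ω, R ω = ∫⁻ d, Gᶜ.indicator (pathEnergy x) d ∂(empirical m V n ω) := fun ω =>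
      (lintegral_indicator hG.compl _).symm
    have hi : Measurable (Gᶜ.indicator (pathEnergy x)) := hE.indicator hG.compl
    have hRm : Measurable R := by
      rw [funext hRe]
      simp_rw [lintegral_empirical m V n _ hi]
      fun_prop
    calc μ {ω | a ≤ R ω} ≤ (∫⁻ ω, R ω ∂μ) / a := meas_ge_le_lintegral_div hRm.aemeasurable ha0 hat
      _ = (∫⁻ d in Gᶜ, pathEnergy x d ∂ν) / a := by
          simp_rw [hRe]
          rw [lintegral_lintegral_empirical hV hlaw hm0 hi, lintegral_indicator hG.compl]
      _ ≤ (a * (ε / 2)) / a := ENNReal.div_le_div_right hMε _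
      _ = ε / 2 := by rw [mul_comm, ENNReal.mul_div_cancel_right ha0 hat]
  have hae := lintegral_empirical_ne_top_ae (n := n) (m := m) hV hlaw hm0 hE hν
  -- Monotonicity of `μ` as an outer measure suffices, so the bad event need not be shown
  -- measurable.
  calc μ _ ≤ μ ({ω | a ^ 2 ≤ W ω} ∪ {ω | a ≤ R ω}) := by
        refine measure_mono_ae ?_
        filter_upwards [hae] with ω hω hbad
        by_contra hcon
        have hcon' : ¬ (a ^ 2 ≤ W ω ∨ a ≤ R ω) := hcon
        push Not at hcon'
        refine hbad fun f h => ?_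
        rw [abs_sub_comm]
        refine abs_le_of_enorm_le hδ.le
          (enorm_kernelForm_sub_le hx (empirical m V n ω) ν hω hν hG f h) ?_
        refine le_trans (add_le_add (add_le_add ?_ hcon'.2.le) hMa) haaa
        calc W ω ^ (1 / 2 : ℝ) ≤ (a ^ 2) ^ (1 / 2 : ℝ) :=
              ENNReal.rpow_le_rpow hcon'.1.le (by norm_num)
          _ = a := by rw [← ENNReal.rpow_natCast, ← ENNReal.rpow_mul]; simp
    _ ≤ ε / 2 + ε / 2 := (measure_union_le _ _).trans (add_le_add hRW hRR)
    _ = ε := ENNReal.add_halves ε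

end Consistency

/-! ### The marginal covariance as a second moment kernel -/

section MarginalCovariance

open scoped ENNReal

variable {E : Type*} [MeasurableSpace E] {P : Measure E} [SFinite P]
  {X : E → I → I → ℝ} {g : I → ℝ}

/-- A continuous density on a compact interval is bounded, so it can be replaced by a constant and
A1 applies. -/
theorem lintegral_pathEnergy_prod_ne_top
    (hX : Measurable fun p : E × I × I => X p.1 p.2.1 p.2.2)
    (hA1 : ∫⁻ e, (∫⁻ s : I, (∫⁻ t : I, ‖X e s t‖ₑ ^ 2)) ∂P < ⊤) (hg : Continuous g) :
    ∫⁻ d, pathEnergy (fun (d : E × I) s => X d.1 s d.2) d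
      ∂(P.prod (volume.withDensity fun t => ENNReal.ofReal (g t))) ≠ ⊤ := by
  have hgm : Measurable fun t => ENNReal.ofReal (g t) := hg.measurable.ennreal_ofReal
  have hx : Measurable fun p : (E × I) × I => X p.1.1 p.2 p.1.2 :=
    hX.comp (measurable_fst.fst.prodMk (measurable_snd.prodMk measurable_fst.snd))
  have hE := measurable_pathEnergy (x := fun (d : E × I) s => X d.1 s d.2) hx
  obtain ⟨C, hC⟩ := (isCompact_range hg).bddAbove
  have hgC : ∀ t, ENNReal.ofReal (g t) ≤ ENNReal.ofReal C := fun t =>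
    ENNReal.ofReal_le_ofReal (hC ⟨t, rfl⟩)
  rw [lintegral_prod _ hE.aemeasurable]
  have hle : ∀ e, ∫⁻ t, pathEnergy (fun (d : E × I) s => X d.1 s d.2) (e, t)
      ∂(volume.withDensity fun t => ENNReal.ofReal (g t)) ≤
      ENNReal.ofReal C * ∫⁻ s : I, ∫⁻ t : I, ‖X e s t‖ₑ ^ 2 := fun e => by
    have hEe : Measurable fun t => pathEnergy (fun (d : E × I) s => X d.1 s d.2) (e, t) :=
      hE.comp measurable_prodMk_left
    rw [lintegral_withDensity_eq_lintegral_mul _ hgm hEe]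
    have hXe : Measurable fun q : I × I => ‖X e q.1 q.2‖ₑ ^ 2 :=
      (hX.comp measurable_prodMk_left).enorm.pow_const 2
    rw [lintegral_lintegral_swap (f := fun s t => ‖X e s t‖ₑ ^ 2) hXe.aemeasurable,
      ← lintegral_const_mul _ hXe.lintegral_prod_left']
    exact lintegral_mono fun t => mul_le_mul_left (hgC t) _
  refine ((lintegral_mono hle).trans_lt ?_).ne
  rw [lintegral_const_mul' _ _ ENNReal.ofReal_ne_top]
  exact ENNReal.mul_lt_top ENNReal.ofReal_lt_top hA1

theorem integrable_pair_of_lintegral_pathEnergy {D : Type*} [MeasurableSpace D] {x : D → I → ℝ}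
    (hx : Measurable fun p : D × I => x p.1 p.2) (ρ : Measure D) [SFinite ρ]
    (hρ : ∫⁻ d, pathEnergy x d ∂ρ ≠ ⊤) :
    ∀ᵐ s : I, ∀ᵐ s' : I, Integrable (fun d => x d s * x d s') ρ := by
  have h1 : ∫⁻ s : I, ∫⁻ d, ‖x d s‖ₑ ^ 2 ∂ρ ≠ ⊤ := by
    rw [lintegral_lintegral_swap (f := fun s d => ‖x d s‖ₑ ^ 2)
      ((hx.comp measurable_swap).enorm.pow_const 2).aemeasurable]
    exact hρ
  have hxs : ∀ s, Measurable fun d => x d s := fun s => hx.comp measurable_prodMk_right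
  have h2 : ∀ᵐ s : I, MemLp (fun d => x d s) 2 ρ := by
    filter_upwards [ae_lt_top ((hx.comp measurable_swap).enorm.pow_const 2).lintegral_prod_right'
      h1] with s hs
    refine ⟨(hxs s).aestronglyMeasurable, ?_⟩
    rw [eLpNorm_lt_top_iff_lintegral_rpow_enorm_lt_top (by simp) (by simp)]
    simpa using hs
  filter_upwards [h2] with s hs
  filter_upwards [h2] with s' hs'
  exact hs.integrable_mul hs'

/-- The marginal covariance function is the second moment kernel of `X(·, t)` under the joint law
of the process and the visit time. -/
theorem marginalCov_eq_secondMoment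
    (hX : Measurable fun p : E × I × I => X p.1 p.2.1 p.2.2)
    (hmean : ∀ s t, ∫ e, X e s t ∂P = 0) (hg0 : ∀ t, 0 ≤ g t) (hg : Continuous g)
    (hfin : ∫⁻ d, pathEnergy (fun (d : E × I) s => X d.1 s d.2) d
      ∂(P.prod (volume.withDensity fun t => ENNReal.ofReal (g t))) ≠ ⊤) :
    ∀ᵐ s : I, ∀ᵐ s' : I, marginalCov P X g s s' =
      secondMoment (fun (d : E × I) s => X d.1 s d.2)
        (P.prod (volume.withDensity fun t => ENNReal.ofReal (g t))) s s' := by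
  have hgm : Measurable fun t => ENNReal.ofReal (g t) := hg.measurable.ennreal_ofReal
  have hx : Measurable fun p : (E × I) × I => X p.1.1 p.2 p.1.2 :=
    hX.comp (measurable_fst.fst.prodMk (measurable_snd.prodMk measurable_fst.snd))
  filter_upwards [integrable_pair_of_lintegral_pathEnergy
    (x := fun (d : E × I) s => X d.1 s d.2) hx _ hfin] with s hs
  filter_upwards [hs] with s' hss
  unfold marginalCov secondMoment covFun covariance
  -- Fubini requires the integrability `hss`, available only for almost every `s`, `s'`.
  rw [integral_prod_symm _ hss, integral_withDensity_eq_integral_toReal_smul hgm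
    (Eventually.of_forall fun _ => ENNReal.ofReal_lt_top)]
  refine integral_congr_ae (Eventually.of_forall fun t => ?_)
  simp only [hmean, sub_zero, ENNReal.toReal_ofReal (hg0 t), smul_eq_mul]
  ring

end MarginalCovariance

/-! ### Spectral gap and conclusion -/

/-- By monotonicity the nearest eigenvalues are the neighbours; index `0` has only a lower one.
Positivity of `ev (k + 1)` keeps the lower gap below `ev k`. -/
theorem StrictAnti.exists_pos_gap {ev : ℕ → ℝ} (h : StrictAnti ev) (hpos : ∀ k, 0 < ev k) (k : ℕ) :
    ∃ γ > 0, (∀ i ≠ k, γ ≤ |ev i - ev k|) ∧ γ ≤ ev k := by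
  have hlow : ∀ i, k < i → ev k - ev (k + 1) ≤ |ev i - ev k| := fun i hi => by
    rw [abs_sub_comm]
    exact (sub_le_sub_left (h.antitone hi) _).trans (le_abs_self _)
  have h1 : 0 < ev k - ev (k + 1) := sub_pos.2 (h (Nat.lt_succ_self k))
  rcases Nat.eq_zero_or_pos k with rfl | hk
  · exact ⟨_, h1, fun i hi => hlow i (Nat.pos_of_ne_zero hi), by linarith [hpos (0 + 1)]⟩
  · have h2 : 0 < ev (k - 1) - ev k := sub_pos.2 (h (by omega))
    refine ⟨min (ev k - ev (k + 1)) (ev (k - 1) - ev k), lt_min h1 h2, fun i hi => ?_,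
      (min_le_left _ _).trans (by linarith [hpos (k + 1)])⟩
    rcases lt_or_gt_of_ne hi with hik | hik
    · have := h.antitone (show i ≤ k - 1 by omega)
      exact (min_le_right _ _).trans ((by linarith : _ ≤ ev i - ev k).trans (le_abs_self _))
    · exact (min_le_left _ _).trans (hlow i hik)

theorem corollary1
    -- the process `X`, on the probability space `(E, P)`: jointly measurable, zero mean
    {E : Type*} [MeasurableSpace E] (P : Measure E) [IsProbabilityMeasure P]
    (X : E → I → I → ℝ) (hX : Measurable fun p : E × I × I => X p.1 p.2.1 p.2.2)
    (hmean : ∀ s t, Integrable (fun e => X e s t) P ∧ ∫ e, X e s t ∂P = 0)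
    -- A1: square integrability of `X`
    (hA1 : ∫⁻ e, (∫⁻ s : I, (∫⁻ t : I, ‖X e s t‖ₑ ^ 2)) ∂P < ⊤)
    -- A2: the sampling density `g` is continuous (and so bounded on `[0,1]`)
    (g : I → ℝ) (hg0 : ∀ t, 0 ≤ g t) (hA2 : Continuous g)
    -- A4: fourth moments of the `L²` norm of `X(·, t)`
    (hA4 : ∀ t : I, ∫⁻ e, (∫⁻ s : I, ‖X e s t‖ₑ ^ 2) ^ 2 ∂P < ⊤)
    -- the data: `Xᵢ(s, t) = X (U i ω) s t` are i.i.d. copies of `X`, `T i j` are the visit times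
    {Ω : Type*} [MeasurableSpace Ω] (μ : Measure Ω) [IsProbabilityMeasure μ]
    (U : ℕ → Ω → E) (hU : ∀ i, Measurable (U i)) (hUlaw : ∀ i, μ.map (U i) = P)
    (T : ℕ → ℕ → Ω → I) (hT : ∀ i j, Measurable (T i j))
    (hTlaw : ∀ i j, μ.map (T i j) = volume.withDensity fun t => ENNReal.ofReal (g t))
    (hindep : iIndepFun (fun i ω => (U i ω, fun j => T i j ω)) μ)
    (hUT : ∀ i, IndepFun (U i) (fun ω j => T i j ω) μ)
    -- sparse longitudinal design (satisfied, for instance, by bounded `m`)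
    (m : ℕ → ℕ) (hm1 : ∀ i, 1 ≤ m i)
    (hm : Tendsto (fun n => (∑ i ∈ Finset.range n, (m i : ℝ) ^ 2) /
      (∑ i ∈ Finset.range n, (m i : ℝ)) ^ 2) atTop (𝓝 0))
    -- eigenvalues and eigenfunctions of `Σ`, with A5: positive eigenvalues without ties
    (ev : ℕ → ℝ) (ef : ℕ → L2I)
    (hspec : IsSpectralDecomposition (marginalCov P X g) ev ef)
    (hA5 : StrictAnti ev ∧ ∀ k, 0 < ev k)
    -- eigenvalues and eigenfunctions of the sample covariance, the latter with the usual sign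
    (evHat : ℕ → Ω → ℕ → ℝ) (efHat : ℕ → Ω → ℕ → L2I)
    (hspecHat : ∀ n, ∀ᵐ ω ∂μ, IsSpectralDecomposition
      (sampleCov m (fun i j s => X (U i ω) s (T i j ω)) n) (evHat n ω) (efHat n ω))
    (hsign : ∀ n, ∀ᵐ ω ∂μ, ∀ k, 0 ≤ inner ℝ (efHat n ω k) (ef k)) :
    ∀ k, TendstoInMeasure μ (fun n ω => evHat n ω k) atTop (fun _ => ev k) ∧
      TendstoInMeasure μ (fun n ω => efHat n ω k) atTop (fun _ => ef k) := by
  have hgm : Measurable fun t => ENNReal.ofReal (g t) := hA2.measurable.ennreal_ofReal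
  set τ : Measure I := volume.withDensity fun t => ENNReal.ofReal (g t) with hτ
  have hx : Measurable fun p : (E × I) × I => X p.1.1 p.2 p.1.2 :=
    hX.comp (measurable_fst.fst.prodMk (measurable_snd.prodMk measurable_fst.snd))
  let x : E × I → I → ℝ := fun d s => X d.1 s d.2
  let V : ℕ → ℕ → Ω → E × I := fun i j ω => (U i ω, T i j ω)
  have hV : ∀ i j, Measurable (V i j) := fun i j => (hU i).prodMk (hT i j)
  have hlaw : ∀ i j, μ.map (V i j) = P.prod τ := fun i j => by
    have h1 : IndepFun (U i) (T i j) μ :=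
      (hUT i).comp (φ := id) (ψ := fun v : ℕ → I => v j) measurable_id (measurable_pi_apply j)
    rw [← hUlaw i, ← hTlaw i j]
    exact (indepFun_iff_map_prod_eq_prod_map_map (hU i).aemeasurable (hT i j).aemeasurable).1 h1
  have hind : Pairwise fun i i' => IndepFun (fun ω j => V i j ω) (fun ω j => V i' j ω) μ := by
    intro i i' hii
    have hφ : Measurable fun (q : E × (ℕ → I)) (j : ℕ) => (q.1, q.2 j) :=
      measurable_pi_lambda _ fun j => measurable_fst.prodMk
        ((measurable_pi_apply j).comp measurable_snd)
    exact (hindep.indepFun hii).comp hφ hφ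
  have hν := lintegral_pathEnergy_prod_ne_top hX hA1 hA2
  have hspec' : IsSpectralDecomposition (secondMoment x (P.prod τ)) ev ef :=
    hspec.congr (marginalCov_eq_secondMoment hX (fun s t => (hmean s t).2) hg0 hA2 hν)
  have hbd := isBoundedKernel_secondMoment (x := x) hx (P.prod τ) hν
  have hW : ∀ δ : ℝ, 0 < δ → Tendsto (fun n => μ {ω | ¬ ∀ f h : L2I,
      |kernelForm (secondMoment x (P.prod τ)) f h -
        kernelForm (secondMoment x (empirical m V n ω)) f h| ≤ δ * ‖f‖ * ‖h‖}) atTop (𝓝 0) :=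
    fun δ hδ => tendsto_measure_kernelForm_empirical hx hν hV hlaw hind hm1 hm hδ
  intro k
  obtain ⟨γ, hγ, hgap, hγk⟩ := hA5.1.exists_pos_gap hA5.2 k
  -- The randomness is confined to closeness of the forms, so no measurable choice of `evHat` and
  -- `efHat` is required.
  have key : ∀ δ : ℝ, 0 < δ → ∀ n, 1 ≤ n → ∀ᵐ ω ∂μ, (∀ f h : L2I,
      |kernelForm (secondMoment x (P.prod τ)) f h -
        kernelForm (secondMoment x (empirical m V n ω)) f h| ≤ δ * ‖f‖ * ‖h‖) →
      |evHat n ω k - ev k| ≤ δ ∧ γ * ‖efHat n ω k - ef k‖ ≤ 4 * δ := by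
    intro δ hδ n hn
    have hm0 : 0 < ∑ i ∈ Finset.range n, (m i : ℝ) :=
      Finset.sum_pos (fun i _ => by exact_mod_cast hm1 i) ⟨0, Finset.mem_range.2 hn⟩
    filter_upwards [hspecHat n, hsign n, lintegral_empirical_ne_top_ae hV hlaw hm0
      (measurable_pathEnergy (x := x) hx) hν] with ω h1 h2 h3 h4
    rw [← secondMoment_empirical (x := x) hx m V n ω] at h1
    obtain ⟨h5, h6⟩ := spectral_perturbation hbd
      (isBoundedKernel_secondMoment (x := x) hx _ h3) hspec' h1 hδ.le h4 k
    exact ⟨h5, h6 γ hγ.le hgap hγk (h2 k)⟩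
  constructor
  · rw [tendstoInMeasure_iff_dist]
    intro ε hε
    refine tendsto_of_tendsto_of_tendsto_of_le_of_le' tendsto_const_nhds (hW (ε / 2) (by positivity))
      (Eventually.of_forall fun _ => zero_le) ?_
    filter_upwards [eventually_ge_atTop 1] with n hn
    refine measure_mono_ae ?_
    filter_upwards [key (ε / 2) (by positivity) n hn] with ω hω hbad hall
    have h1 : ε ≤ |evHat n ω k - ev k| := hbad
    linarith [(hω hall).1]
  -- With `δ = γ * ε / 8` the bound `4 * δ` is `γ * ε / 2`, strictly below `γ * ε`.
  · rw [tendstoInMeasure_iff_norm]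
    intro ε hε
    refine tendsto_of_tendsto_of_tendsto_of_le_of_le' tendsto_const_nhds
      (hW (γ * ε / 8) (by positivity)) (Eventually.of_forall fun _ => zero_le) ?_
    filter_upwards [eventually_ge_atTop 1] with n hn
    refine measure_mono_ae ?_
    filter_upwards [key (γ * ε / 8) (by positivity) n hn] with ω hω hbad hall
    have h1 : ε ≤ ‖efHat n ω k - ef k‖ := hbad
    have h2 := (hω hall).2
    nlinarith [mul_le_mul_of_nonneg_left h1 hγ.le, mul_pos hγ hε]
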